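/- All graphs are finite and simple. For a connected graph $G$ on $n$ vertices let $\partial_1(G)\ge\partial_2(G)\ge\cdots\ge\partial_n(G)$ be the eigenvalues, with multiplicity, of its distance matrix $D(G)=(d(u,v))_{u,v}$. Let $\mathcal{G}[-3\le\partial_n,\partial_3\le-1]$ be the set of connected, non-complete graphs $G$ on $n\ge4$ vertices with $\partial_n(G)\ge-3$ and $\partial_3(G)\le-1$. Write $G\vee H$ for the join of two vertex-disjoint graphs (their disjoint union together with all edges between them), $G\cup H$ for the disjoint union, $mH$ for the disjoint union of $m\ge0$ copies of $H$, $K_n$ for the complete graph on $n$ vertices, and $P_3$ for the path on three vertices. Theorem 3.12. Let $G\cong G_1\vee G_2$, where $G_1$ and $G_2$ have at least one vertex each, and suppose that $G\in\mathcal{G}[-3\le\partial_n,\partial_3\le-1]$. (i) If neither $G_1$ nor $G_2$ contains an induced $P_3$, then $G$ is one of the following, for some non-negative integers as indicated: (a) $G\cong K_r\vee(K_s\cup tK_1)$ with $r,t\ge1$ and $s\ge3$; (b) $G\cong K_r\vee(mK_2\cup tK_1)$ with $r\ge1$ and $m+t\ge2$; (c) $G\cong(K_{s_1}\cup t_1K_1)\vee(K_{s_2}\cup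 t_2K_1)$ with $s_1,s_2\ge3$ and $t_1,t_2\ge1$; (d) $G\cong(K_s\cup t_1K_1)\vee(mK_2\cup t_2K_1)$ with $s\ge3$, $t_1\ge1$ and $m+t_2\ge2$; (e) $G\cong(m_1K_2\cup t_1K_1)\vee(m_2K_2\cup t_2K_1)$ with $m_1+t_1\ge2$ and $m_2+t_2\ge2$. (ii) If $G_1$ or $G_2$ contains an induced $P_3$, then $G\cong K_r\vee F_1\vee F_2$ for some $r\ge1$ and some graphs $F_1,F_2$, each with at least one vertex and neither containing an induced $P_3$. -/

import Mathlib

open scoped SimpleGraph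

namespace SimpleGraph

/-- The join of two vertex-disjoint graphs: their disjoint union together with all edges
having one end in each of them. -/
def join {V W : Type*} (G : SimpleGraph V) (H : SimpleGraph W) : SimpleGraph (V ⊕ W) :=
  (G ⊕g H) ⊔ completeBipartiteGraph V W

/-- The disjoint union of `m` copies of a graph `H`; the first coordinate tells the copy. -/
def copies {V : Type*} (m : ℕ) (H : SimpleGraph V) : SimpleGraph (Fin m × V) where
  Adj x y := x.1 = y.1 ∧ H.Adj x.2 y.2
  symm := ⟨fun _ _ h => ⟨h.1.symm, h.2.symm⟩⟩
  loopless := ⟨fun _ h => H.irrefl h.2⟩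

/-- The complete graph `K_n` on `n` vertices. -/
abbrev clique (n : ℕ) : SimpleGraph (Fin n) := completeGraph (Fin n)

/-- The graph `K_s ∪ t K_1`. -/
abbrev cliqueUnionIsolated (s t : ℕ) : SimpleGraph (Fin s ⊕ Fin t × Fin 1) :=
  clique s ⊕g copies t (clique 1)

/-- The graph `m K_2 ∪ t K_1`. -/
abbrev edgesUnionIsolated (m t : ℕ) : SimpleGraph (Fin m × Fin 2 ⊕ Fin t × Fin 1) :=
  copies m (clique 2) ⊕g copies t (clique 1)

/-- `G` contains the path on three vertices as an induced subgraph. -/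
def HasInducedP3 {V : Type*} (G : SimpleGraph V) : Prop := pathGraph 3 ⊴ G

/-- The distance matrix of a graph. -/
noncomputable def distanceMatrix {V : Type*} (G : SimpleGraph V) : Matrix V V ℝ :=
  Matrix.of fun u v => (G.dist u v : ℝ)

theorem distanceMatrix_isHermitian {V : Type*} (G : SimpleGraph V) :
    G.distanceMatrix.IsHermitian := by
  ext u v
  simp [distanceMatrix, SimpleGraph.dist_comm]

/-- The distance eigenvalues `∂₁ ≥ ∂₂ ≥ ⋯ ≥ ∂ₙ` of `G`, listed with multiplicity in weakly
decreasing order. The index starts at `0`: `∂ₖ` is the value at `k - 1`. -/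
noncomputable def distanceEigenvalue {V : Type*} [Fintype V] [DecidableEq V]
    (G : SimpleGraph V) : Fin (Fintype.card V) → ℝ :=
  G.distanceMatrix_isHermitian.eigenvalues₀

/-- The class `𝒢[-3 ≤ ∂ₙ, ∂₃ ≤ -1]`: non-complete connected graphs on `n ≥ 4` vertices whose
least distance eigenvalue is at least `-3` and whose third largest one is at most `-1`. -/
def InClassG {V : Type*} [Fintype V] [DecidableEq V] (G : SimpleGraph V) : Prop :=
  G.Connected ∧ G ≠ ⊤ ∧ ∃ hn : 4 ≤ Fintype.card V,
    -3 ≤ G.distanceEigenvalue ⟨Fintype.card V - 1, by omega⟩ ∧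
    G.distanceEigenvalue ⟨2, by omega⟩ ≤ -1

end SimpleGraph

/-! In a join, nonadjacent vertices have a common neighbour, so all distances are 0, 1 or 2 and each
eigenvalue bound can be tested on vectors supported on a few vertices.

For (i), the least eigenvalue being at least -3 forbids an induced K₃ ∪ K₂
(`not_triangle_union_edge`). A side without induced P₃ is a disjoint union of cliques, so it is
complete, K_s ∪ tK₁ or mK₂ ∪ tK₁; the sides are not both complete.

For (ii), ∂₃ ≤ -1 says that D + I is positive definite on no 3-dimensional space, whence
`not_two_nonadjacent_pairs`. This forces the middle of an induced P₃ in one side to dominate that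
side, and the other side to be complete. Deleting the dominating vertices of the first side then
leaves no induced P₃. -/

namespace Matrix.IsHermitian

/-! ### Eigenvalue bounds as bounds on the quadratic form -/

/-- A real symmetric matrix is diagonalized by orthonormal coordinates whose quadratic
form lists the eigenvalues in decreasing order. -/
theorem exists_coordinates {V : Type*} [Fintype V] [DecidableEq V] {A : Matrix V V ℝ}
    (hA : A.IsHermitian) :
    ∃ c : Fin (Fintype.card V) → (V → ℝ) →ₗ[ℝ] ℝ, ∀ x : V → ℝ,
      x ⬝ᵥ x = ∑ i, c i x ^ 2 ∧ x ⬝ᵥ A *ᵥ x = ∑ i, hA.eigenvalues₀ i * c i x ^ 2 := by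
  -- This is the reindexing by which `eigenvalues` is defined from `eigenvalues₀`.
  let e : Fin (Fintype.card V) ≃ V := Fintype.equivOfCardEq (Fintype.card_fin _)
  let b := hA.eigenvectorBasis
  have hsum (x y : V → ℝ) : x ⬝ᵥ y = ∑ v, (WithLp.ofLp (b v) ⬝ᵥ x) * (WithLp.ofLp (b v) ⬝ᵥ y) := by
    have h := b.sum_inner_mul_inner (WithLp.toLp 2 x) (WithLp.toLp 2 y)
    simp only [EuclideanSpace.inner_eq_star_dotProduct, star_trivial] at h
    rw [dotProduct_comm, ← h]
    exact Finset.sum_congr rfl fun v _ => by rw [dotProduct_comm y]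
  refine ⟨fun i => ⟨⟨fun x => WithLp.ofLp (b (e i)) ⬝ᵥ x, fun x y => dotProduct_add _ _ _⟩,
    fun r x => dotProduct_smul _ _ _⟩, fun x => ⟨?_, ?_⟩⟩
  · rw [hsum x x, ← e.sum_comp]
    simp [sq]
  · rw [hsum x (A *ᵥ x), ← e.sum_comp]
    refine Finset.sum_congr rfl fun i _ => ?_
    have hmul : WithLp.ofLp (b (e i)) ⬝ᵥ A *ᵥ x =
        hA.eigenvalues₀ i * (WithLp.ofLp (b (e i)) ⬝ᵥ x) := by
      have hT : Aᵀ = A := by simpa [IsHermitian, conjTranspose] using hA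
      rw [dotProduct_mulVec, ← mulVec_transpose, hT, hA.mulVec_eigenvectorBasis,
        smul_dotProduct, smul_eq_mul]
      congr 1
      simp [eigenvalues, e]
    rw [hmul]
    simp only [LinearMap.coe_mk, AddHom.coe_mk]
    ring

/-- A lower bound for the least eigenvalue bounds the quadratic form from below. -/
theorem le_dotProduct_mulVec {V : Type*} [Fintype V] [DecidableEq V] {A : Matrix V V ℝ}
    (hA : A.IsHermitian) {r : ℝ} (h : ∀ i, r ≤ hA.eigenvalues₀ i) (x : V → ℝ) :
    r * (x ⬝ᵥ x) ≤ x ⬝ᵥ A *ᵥ x := by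
  obtain ⟨c, hc⟩ := hA.exists_coordinates
  rw [(hc x).1, (hc x).2, Finset.mul_sum]
  exact Finset.sum_le_sum fun i _ => mul_le_mul_of_nonneg_right (h i) (sq_nonneg _)

/-- An upper bound for the `k`-th eigenvalue bounds the quadratic form from above at some
nontrivial combination of any `k + 1` vectors (indices starting at `0`). -/
theorem exists_dotProduct_mulVec_le {V : Type*} [Fintype V] [DecidableEq V] {A : Matrix V V ℝ}
    (hA : A.IsHermitian) {r : ℝ} {k : ℕ} (hk : k < Fintype.card V)
    (h : hA.eigenvalues₀ ⟨k, hk⟩ ≤ r) (p : Fin (k + 1) → V → ℝ) :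
    ∃ a : Fin (k + 1) → ℝ, a ≠ 0 ∧
      (∑ i, a i • p i) ⬝ᵥ A *ᵥ (∑ i, a i • p i) ≤
        r * ((∑ i, a i • p i) ⬝ᵥ (∑ i, a i • p i)) := by
  obtain ⟨c, hc⟩ := hA.exists_coordinates
  -- Vanishing of the first k coordinates is k linear conditions on k + 1 coefficients; a nonzero
  -- solution sees only eigenvalues of index at least k.
  let L : (Fin (k + 1) → ℝ) →ₗ[ℝ] (Fin k → ℝ) :=
    LinearMap.pi (fun j : Fin k => c ⟨j, j.2.trans hk⟩) ∘ₗ Fintype.linearCombination ℝ p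
  obtain ⟨a, ha, ha0⟩ := Submodule.exists_mem_ne_zero_of_ne_bot
    (LinearMap.ker_ne_bot_of_finrank_lt (f := L) (by simp))
  refine ⟨a, ha0, ?_⟩
  set x := ∑ i, a i • p i with hx
  have hzero : ∀ j : Fin k, c ⟨j, j.2.trans hk⟩ x = 0 := fun j => by
    have := congrFun (LinearMap.mem_ker.1 ha) j
    simpa [L, Fintype.linearCombination_apply, hx] using this
  rw [(hc x).1, (hc x).2, Finset.mul_sum]
  refine Finset.sum_le_sum fun i _ => ?_
  by_cases hi : (i : ℕ) < k
  · have := hzero ⟨i, hi⟩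
    simp only [Fin.eta] at this
    simp [this]
  · exact mul_le_mul_of_nonneg_right
      ((hA.eigenvalues₀_antitone (Fin.mk_le_of_le_val (by omega))).trans h) (sq_nonneg _)

end Matrix.IsHermitian

/-- A quadratic form at a vector given as a combination of unit vectors. -/
theorem Matrix.sum_single_dotProduct_mulVec {V ι : Type*} [Fintype V] [DecidableEq V] [Fintype ι]
    (A : Matrix V V ℝ) (w : ι → V) (c : ι → ℝ) :
    (∑ i, c i • (Pi.single (w i) 1 : V → ℝ)) ⬝ᵥ A.mulVec (∑ i, c i • Pi.single (w i) 1) =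
      ∑ i, ∑ j, c i * c j * A (w i) (w j) := by
  simp only [sum_dotProduct, Matrix.mulVec_sum, dotProduct_sum, smul_dotProduct,
    Matrix.mulVec_smul, dotProduct_smul, smul_eq_mul]
  rw [Finset.sum_comm]
  simp [Finset.mul_sum, mul_assoc, mul_left_comm]

/-! ### Forbidden configurations at diameter at most two -/

namespace SimpleGraph

/-- Distance at most two: nonadjacent vertices have a common neighbour. -/
def HasCommonNeighbors {V : Type*} (G : SimpleGraph V) : Prop :=
  ∀ u v, u ≠ v → ¬ G.Adj u v → ∃ w, G.Adj u w ∧ G.Adj w v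

section
variable {V : Type*} {G : SimpleGraph V}

theorem distanceMatrix_self (v : V) : G.distanceMatrix v v = 0 := by
  simp [distanceMatrix]

theorem distanceMatrix_of_adj {u v : V} (h : G.Adj u v) : G.distanceMatrix u v = 1 := by
  simp [distanceMatrix, SimpleGraph.dist_eq_one_iff_adj.2 h]

theorem HasCommonNeighbors.distanceMatrix_of_not_adj (hG : G.HasCommonNeighbors) {u v : V}
    (hne : u ≠ v) (h : ¬ G.Adj u v) : G.distanceMatrix u v = 2 := by
  obtain ⟨w, huw, hwv⟩ := hG u v hne h
  have h2 : G.dist u v ≤ 2 := SimpleGraph.dist_le (Walk.cons huw (Walk.cons hwv Walk.nil))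
  have h0 : G.dist u v ≠ 0 := fun h0 => by
    rcases SimpleGraph.dist_eq_zero_iff_eq_or_not_reachable.1 h0 with h0 | h0
    · exact hne h0
    · exact h0 (huw.reachable.trans hwv.reachable)
  have h1 : G.dist u v ≠ 1 := fun h1 => h (SimpleGraph.dist_eq_one_iff_adj.1 h1)
  have : G.dist u v = 2 := by omega
  simp [distanceMatrix, this]

theorem distanceMatrix_comm (u v : V) : G.distanceMatrix u v = G.distanceMatrix v u := by
  simp [distanceMatrix, SimpleGraph.dist_comm]

variable [Fintype V] [DecidableEq V]

theorem InClassG.neg_three_mul_le (h : G.InClassG) (x : V → ℝ) :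
    -3 * (x ⬝ᵥ x) ≤ x ⬝ᵥ G.distanceMatrix.mulVec x := by
  obtain ⟨-, -, hn, h3, -⟩ := h
  exact G.distanceMatrix_isHermitian.le_dotProduct_mulVec (fun i => h3.trans
    (G.distanceMatrix_isHermitian.eigenvalues₀_antitone (Fin.mk_le_mk.2 (by omega)))) x

theorem InClassG.exists_le_neg (h : G.InClassG) (p : Fin 3 → V → ℝ) :
    ∃ a : Fin 3 → ℝ, a ≠ 0 ∧
      (∑ i, a i • p i) ⬝ᵥ G.distanceMatrix.mulVec (∑ i, a i • p i) ≤
        -1 * ((∑ i, a i • p i) ⬝ᵥ (∑ i, a i • p i)) := by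
  obtain ⟨-, -, hn, -, h1⟩ := h
  exact G.distanceMatrix_isHermitian.exists_dotProduct_mulVec_le (by omega) h1 p

/-- A graph of the class has no vertex adjacent to four vertices that induce, in the
complement, a graph with two positive eigenvalues: there cannot be two nonadjacent pairs
`x, z` and `y, u` with `y` adjacent to `x` and `z`, and a fifth vertex adjacent to all four. -/
theorem InClassG.not_two_nonadjacent_pairs (h : G.InClassG) (hG : G.HasCommonNeighbors)
    {x z y u w : V} (hxz : x ≠ z) (hyu : y ≠ u) (nxz : ¬ G.Adj x z) (nyu : ¬ G.Adj y u)
    (hyx : G.Adj y x) (hyz : G.Adj y z) (hwx : G.Adj w x) (hwz : G.Adj w z) (hwy : G.Adj w y)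
    (hwu : G.Adj w u) : False := by
  have hux : u ≠ x := fun e => nyu (e ▸ hyx)
  have huz : u ≠ z := fun e => nyu (e ▸ hyz)
  -- The distances from u to x and z are not determined, so they stay as parameters.
  set α := G.distanceMatrix u x - 1 with hα
  set β := G.distanceMatrix u z - 1 with hβ
  -- D + I is the all-ones matrix plus a matrix vanishing on w. The w-entries make the first two
  -- rows sum to zero, and -(α + β) makes them orthogonal, so D + I becomes diagonal with entries 2,
  -- 2, 1.
  let P : Fin 3 → Fin 5 → ℝ :=
    ![![1, 1, -(α + β), 0, α + β - 2], ![0, 0, 1, 1, -2], ![0, 0, 0, 0, 1]]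
  let f : Fin 5 → V := ![x, z, y, u, w]
  obtain ⟨a, ha, hle⟩ := h.exists_le_neg fun i => ∑ j, P i j • Pi.single (f j) 1
  have hcomb : ∑ i, a i • ∑ j, P i j • (Pi.single (f j) 1 : V → ℝ) =
      ∑ j, (∑ i, a i * P i j) • Pi.single (f j) 1 := by
    simp only [Finset.smul_sum, smul_smul, Finset.sum_smul]
    exact Finset.sum_comm
  have hone := Matrix.sum_single_dotProduct_mulVec (1 : Matrix V V ℝ) f (fun j => ∑ i, a i * P i j)
  rw [Matrix.one_mulVec] at hone
  rw [hcomb, hone, Matrix.sum_single_dotProduct_mulVec] at hle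
  have dux : G.distanceMatrix u x = α + 1 := by rw [hα]; ring
  have duz : G.distanceMatrix u z = β + 1 := by rw [hβ]; ring
  have dxu : G.distanceMatrix x u = α + 1 := by rw [distanceMatrix_comm, dux]
  have dzu : G.distanceMatrix z u = β + 1 := by rw [distanceMatrix_comm, duz]
  simp only [Fin.sum_univ_five, Fin.sum_univ_three, P, f, Matrix.cons_val,
    Matrix.one_apply, distanceMatrix_self, dux, duz, dxu, dzu,
    distanceMatrix_of_adj hyx, distanceMatrix_of_adj hyx.symm, distanceMatrix_of_adj hyz,
    distanceMatrix_of_adj hyz.symm, distanceMatrix_of_adj hwx, distanceMatrix_of_adj hwx.symm,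
    distanceMatrix_of_adj hwy, distanceMatrix_of_adj hwy.symm, distanceMatrix_of_adj hwz,
    distanceMatrix_of_adj hwz.symm, distanceMatrix_of_adj hwu, distanceMatrix_of_adj hwu.symm,
    hG.distanceMatrix_of_not_adj hxz nxz,
    hG.distanceMatrix_of_not_adj hxz.symm (fun e => nxz e.symm),
    hG.distanceMatrix_of_not_adj hyu nyu,
    hG.distanceMatrix_of_not_adj hyu.symm (fun e => nyu e.symm), hxz, hxz.symm, hyu, hyu.symm,
    hux, hux.symm, huz, huz.symm, hyx.ne, hyx.ne', hyz.ne, hyz.ne', hwx.ne, hwx.ne', hwy.ne,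
    hwy.ne', hwz.ne, hwz.ne', hwu.ne, hwu.ne', if_true, if_false] at hle
  have hpos : 2 * a 0 ^ 2 + 2 * a 1 ^ 2 + a 2 ^ 2 ≤ 0 := by linarith
  clear hle
  have h0 : a 0 = 0 := by nlinarith only [hpos, sq_nonneg (a 0), sq_nonneg (a 1), sq_nonneg (a 2)]
  have h1 : a 1 = 0 := by nlinarith only [hpos, sq_nonneg (a 0), sq_nonneg (a 1), sq_nonneg (a 2)]
  have h2 : a 2 = 0 := by nlinarith only [hpos, sq_nonneg (a 0), sq_nonneg (a 1), sq_nonneg (a 2)]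
  refine ha (funext fun i => ?_)
  fin_cases i
  · exact h0
  · exact h1
  · exact h2

/-- A graph of the class has no induced `K₃ ∪ K₂`. -/
theorem InClassG.not_triangle_union_edge (h : G.InClassG) (hG : G.HasCommonNeighbors)
    {f : Fin 3 → V} {g : Fin 2 → V} (hf : ∀ i j, i ≠ j → G.Adj (f i) (f j))
    (hg : ∀ i j, i ≠ j → G.Adj (g i) (g j))
    (hfg : ∀ i j, f i ≠ g j ∧ ¬ G.Adj (f i) (g j)) : False := by
  have hff : ∀ i j, G.distanceMatrix (f i) (f j) = if i = j then 0 else 1 := fun i j => by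
    split_ifs with hij
    · rw [hij, distanceMatrix_self]
    · exact distanceMatrix_of_adj (hf i j hij)
  have hgg : ∀ i j, G.distanceMatrix (g i) (g j) = if i = j then 0 else 1 := fun i j => by
    split_ifs with hij
    · rw [hij, distanceMatrix_self]
    · exact distanceMatrix_of_adj (hg i j hij)
  have hd : ∀ i j, G.distanceMatrix (f i) (g j) = 2 := fun i j =>
    hG.distanceMatrix_of_not_adj (hfg i j).1 (hfg i j).2
  have hd' : ∀ i j, G.distanceMatrix (g i) (f j) = 2 := fun i j => by
    rw [distanceMatrix_comm, hd]
  have hfi : Function.Injective f := fun i j e => by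
    by_contra hij; exact (hf i j hij).ne e
  have hgi : Function.Injective g := fun i j e => by
    by_contra hij; exact (hg i j hij).ne e
  -- These weights approximate the eigenvector for (3 - √97)/2 ≈ -3.42: the form is -334, below -3 ·
  -- 98 = -294.
  let c : Fin 3 ⊕ Fin 2 → ℝ := Sum.elim (fun _ => -4) (fun _ => 5)
  have hle := h.neg_three_mul_le (∑ i, c i • Pi.single (Sum.elim f g i) 1)
  have hone := Matrix.sum_single_dotProduct_mulVec (1 : Matrix V V ℝ) (Sum.elim f g) c
  rw [Matrix.one_mulVec] at hone
  rw [hone, Matrix.sum_single_dotProduct_mulVec] at hle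
  simp only [Fintype.sum_sum_type, c, Sum.elim_inl, Sum.elim_inr, hff, hgg, hd, hd',
    Matrix.one_apply, hfi.eq_iff, hgi.eq_iff, (hfg _ _).1, ((hfg _ _).1).symm, if_false] at hle
  simp [Fin.sum_univ_three, Fin.sum_univ_two] at hle
  norm_num at hle

end
end SimpleGraph

/-! ### Joins and induced P₃ -/

namespace SimpleGraph

section join
variable {V W V' W' : Type*} {G : SimpleGraph V} {H : SimpleGraph W}

@[simp] theorem join_adj_inl_inl {a b : V} : (G.join H).Adj (.inl a) (.inl b) ↔ G.Adj a b := by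
  simp [join]

@[simp] theorem join_adj_inr_inr {a b : W} : (G.join H).Adj (.inr a) (.inr b) ↔ H.Adj a b := by
  simp [join]

@[simp] theorem join_adj_inl_inr {a : V} {b : W} : (G.join H).Adj (.inl a) (.inr b) := by
  simp [join]

@[simp] theorem join_adj_inr_inl {a : W} {b : V} : (G.join H).Adj (.inr a) (.inl b) := by
  simp [join]

/-- The join of two isomorphisms. -/
def Iso.join {G' : SimpleGraph V'} {H' : SimpleGraph W'} (e : G ≃g G') (f : H ≃g H') :
    G.join H ≃g G'.join H' where
  toEquiv := Equiv.sumCongr e.toEquiv f.toEquiv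
  map_rel_iff' := by
    rintro (a | a) (b | b)
    · simpa using e.map_adj_iff
    · simp
    · simp
    · simpa using f.map_adj_iff

/-- The join is commutative up to isomorphism. -/
def joinComm (G : SimpleGraph V) (H : SimpleGraph W) : G.join H ≃g H.join G where
  toEquiv := Equiv.sumComm V W
  map_rel_iff' := by rintro (a | a) (b | b) <;> simp

theorem hasCommonNeighbors_join [Nonempty V] [Nonempty W] (G : SimpleGraph V)
    (H : SimpleGraph W) : (G.join H).HasCommonNeighbors := by
  rintro (a | a) (b | b) - h
  · exact ⟨.inr (Classical.arbitrary W), by simp⟩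
  · simp at h
  · simp at h
  · exact ⟨.inl (Classical.arbitrary V), by simp⟩

theorem HasCommonNeighbors.of_iso (hH : H.HasCommonNeighbors) (e : G ≃g H) :
    G.HasCommonNeighbors := by
  intro u v hne h
  obtain ⟨w, hu, hv⟩ := hH (e u) (e v) (e.injective.ne hne) (fun h' => h (e.map_adj_iff.1 h'))
  refine ⟨e.symm w, e.map_adj_iff.1 ?_, e.map_adj_iff.1 ?_⟩ <;> simpa

/-- A set of dominating vertices splits off as a clique. -/
noncomputable def isoJoinOfDominating (G : SimpleGraph V) (S : V → Prop) [DecidablePred S]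
    (hS : ∀ a, S a → ∀ b, b ≠ a → G.Adj a b) :
    G ≃g (⊤ : SimpleGraph {a // S a}).join (G.comap (Subtype.val : {a // ¬ S a} → V)) :=
  Iso.symm
    { toEquiv := Equiv.sumCompl S
      map_rel_iff' := by
        rintro (⟨a, ha⟩ | ⟨a, ha⟩) (⟨b, hb⟩ | ⟨b, hb⟩)
        · simp only [Equiv.sumCompl_apply_inl, join_adj_inl_inl, top_adj, ne_eq, Subtype.mk.injEq]
          exact ⟨fun h => h.ne, fun h => hS a ha b (Ne.symm h)⟩
        · simpa using hS a ha b (fun e => hb (e ▸ ha))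
        · simpa using (hS b hb a (fun e => ha (e ▸ hb))).symm
        · simp }

end join

theorem hasInducedP3_iff {V : Type*} {G : SimpleGraph V} :
    G.HasInducedP3 ↔ ∃ x y z, G.Adj y x ∧ G.Adj y z ∧ x ≠ z ∧ ¬ G.Adj x z := by
  constructor
  · rintro ⟨f⟩
    refine ⟨f 0, f 1, f 2, f.map_adj_iff.2 ?_, f.map_adj_iff.2 ?_, f.injective.ne (by decide),
      fun h => ?_⟩
    · simp [pathGraph_adj]
    · simp [pathGraph_adj]
    · simpa [pathGraph_adj] using f.map_adj_iff.1 h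
  · rintro ⟨x, y, z, hx, hz, hne, h⟩
    have h' : ¬ G.Adj z x := fun e => h e.symm
    refine ⟨⟨⟨![x, y, z], ?_⟩, ?_⟩⟩
    · intro i j
      fin_cases i <;> fin_cases j <;> simp [hne, hne.symm, hx.ne, hx.ne', hz.ne, hz.ne']
    · intro i j
      change G.Adj (![x, y, z] i) (![x, y, z] j) ↔ _
      fin_cases i <;> fin_cases j <;> simp [pathGraph_adj, hx, hz, hx.symm, hz.symm, h, h']

theorem HasInducedP3.of_iso {V W : Type*} {G : SimpleGraph V} {H : SimpleGraph W}
    (h : G.HasInducedP3) (e : G ≃g H) : H.HasInducedP3 := by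
  obtain ⟨f⟩ := h
  exact ⟨e.toEmbedding.comp f⟩

/-! ### Disjoint unions of cliques -/

section cluster

/-- Two disjoint unions of cliques with equally many vertices in corresponding cliques are
isomorphic. -/
theorem nonempty_iso_of_card_fiber_eq {V W Q : Type*} [Finite V] [Finite W] {G : SimpleGraph V}
    {H : SimpleGraph W} {f : V → Q} {g : W → Q} (hG : ∀ u v, G.Adj u v ↔ u ≠ v ∧ f u = f v)
    (hH : ∀ u v, H.Adj u v ↔ u ≠ v ∧ g u = g v)
    (hcard : ∀ q, Nat.card {v // f v = q} = Nat.card {w // g w = q}) : Nonempty (G ≃g H) := by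
  let e := Equiv.ofFiberEquiv fun q => (Finite.card_eq.1 (hcard q)).some
  have he (v : V) : g (e v) = f v := Equiv.ofFiberEquiv_map _ v
  exact ⟨⟨e, by simp [hG, hH, he]⟩⟩

theorem nonempty_iso_clique {V : Type*} [Finite V] :
    Nonempty ((⊤ : SimpleGraph V) ≃g clique (Nat.card V)) :=
  ⟨Iso.completeGraph (Finite.equivFin V)⟩

variable {V Q : Type*} [Finite V] {G : SimpleGraph V} {f : V → Q}

/-- The fibres of f are the cliques: m counts those of size two and t those of size one, so m + t is
the number of labels. -/
theorem exists_iso_edgesUnionIsolated [Nontrivial Q]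
    (hG : ∀ u v, G.Adj u v ↔ u ≠ v ∧ f u = f v) (hf : Function.Surjective f)
    (h : ∀ q, Nat.card {v // f v = q} ≤ 2) :
    ∃ m t, 2 ≤ m + t ∧ Nonempty (G ≃g edgesUnionIsolated m t) := by
  classical
  have : Finite Q := Finite.of_surjective f hf
  let p : Q → Prop := fun q => Nat.card {v // f v = q} = 2
  let eA := Finite.equivFin {q // p q}
  let eB := Finite.equivFin {q // ¬ p q}
  refine ⟨Nat.card {q // p q}, Nat.card {q // ¬ p q}, ?_, ?_⟩
  · rw [← Nat.card_sum, Nat.card_congr (Equiv.sumCompl p)]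
    exact Finite.one_lt_card
  refine nonempty_iso_of_card_fiber_eq
    (g := Sum.elim (fun x => (eA.symm x.1).1) (fun x => (eB.symm x.1).1)) hG ?_ fun q => ?_
  · rintro (⟨a, i⟩ | ⟨a, i⟩) (⟨b, j⟩ | ⟨b, j⟩)
    · simp [copies, Subtype.val_inj]
      tauto
    · have h1 := (eA.symm a).2
      have h2 := (eB.symm b).2
      simp only [Sum.elim_inl, Sum.elim_inr]
      constructor
      · intro h; simp at h
      · rintro ⟨-, h⟩; exact absurd (h ▸ h1) h2
    · have h1 := (eB.symm a).2
      have h2 := (eA.symm b).2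
      simp only [Sum.elim_inl, Sum.elim_inr]
      constructor
      · intro h; simp at h
      · rintro ⟨-, h⟩; exact absurd (h ▸ h2) h1
    · simp [copies, Subtype.val_inj, Subsingleton.elim i j]
  · by_cases hq : p q
    · rw [show Nat.card {v // f v = q} = 2 from hq]
      refine (Nat.card_fin 2).symm.trans
        (Nat.card_eq_of_bijective (fun i : Fin 2 => ⟨.inl (eA ⟨q, hq⟩, i), by simp⟩) ⟨?_, ?_⟩)
      · intro i j hij; simpa [Subtype.ext_iff] using hij
      · rintro ⟨⟨a, i⟩ | ⟨a, i⟩, rfl⟩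
        · exact ⟨i, by simp⟩
        · exact absurd hq (eB.symm a).2
    · have h1 : Nat.card {v // f v = q} = 1 := by
        obtain ⟨v, hv⟩ := hf q
        have : Nonempty {v // f v = q} := ⟨⟨v, hv⟩⟩
        have h0 : 0 < Nat.card {v // f v = q} := Nat.card_pos
        have h2 : Nat.card {v // f v = q} ≠ 2 := hq
        have := h q
        omega
      rw [h1]
      refine (Nat.card_fin 1).symm.trans
        (Nat.card_eq_of_bijective (fun i : Fin 1 => ⟨.inr (eB ⟨q, hq⟩, i), by simp⟩) ⟨?_, ?_⟩)
      · intro i j hij; simpa [Subtype.ext_iff] using hij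
      · rintro ⟨⟨a, i⟩ | ⟨a, i⟩, rfl⟩
        · exact absurd (eA.symm a).2 hq
        · exact ⟨i, by simp⟩

/-- The fibre over q₀ is the large clique; each other label contributes one isolated vertex. -/
theorem exists_iso_cliqueUnionIsolated [Nontrivial Q]
    (hG : ∀ u v, G.Adj u v ↔ u ≠ v ∧ f u = f v) (hf : Function.Surjective f) (q₀ : Q)
    (h : ∀ q, q ≠ q₀ → Nat.card {v // f v = q} = 1) :
    ∃ t, 1 ≤ t ∧ Nonempty (G ≃g cliqueUnionIsolated (Nat.card {v // f v = q₀}) t) := by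
  classical
  have : Finite Q := Finite.of_surjective f hf
  let eB := Finite.equivFin {q // q ≠ q₀}
  refine ⟨Nat.card {q // q ≠ q₀}, ?_, ?_⟩
  · obtain ⟨q, hq⟩ := exists_ne q₀
    have : Nonempty {q // q ≠ q₀} := ⟨⟨q, hq⟩⟩
    exact Nat.card_pos
  refine nonempty_iso_of_card_fiber_eq
    (g := Sum.elim (fun _ => q₀) (fun x => (eB.symm x.1).1)) hG ?_ fun q => ?_
  · rintro (i | ⟨a, i⟩) (j | ⟨b, j⟩)
    · simp
    · simpa using (eB.symm b).2.symm
    · simpa using (eB.symm a).2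
    · simp [copies, Subtype.val_inj, Subsingleton.elim i j]
  · by_cases hq : q = q₀
    · subst hq
      refine (Nat.card_fin _).symm.trans
        (Nat.card_eq_of_bijective (fun i : Fin (Nat.card {v // f v = q}) => ⟨.inl i, by simp⟩) ⟨?_, ?_⟩)
      · intro i j hij; simpa [Subtype.ext_iff] using hij
      · rintro ⟨i | ⟨a, i⟩, hi⟩
        · exact ⟨i, by simp⟩
        · exact absurd hi (eB.symm a).2
    · rw [h q hq]
      refine (Nat.card_fin 1).symm.trans
        (Nat.card_eq_of_bijective (fun i : Fin 1 => ⟨.inr (eB ⟨q, hq⟩, i), by simp⟩) ⟨?_, ?_⟩)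
      · intro i j hij; simpa [Subtype.ext_iff] using hij
      · rintro ⟨i | ⟨a, i⟩, hi⟩
        · exact absurd hi.symm hq
        · subst hi
          exact ⟨i, by simp⟩

/-- Classification of the graphs with neither an induced `P₃` nor an induced `K₃ ∪ K₂`. -/
theorem classification_of_not_hasInducedP3 [Nonempty V] (hP : ¬ G.HasInducedP3)
    (hK : ∀ (f : Fin 3 → V) (g : Fin 2 → V), (∀ i j, i ≠ j → G.Adj (f i) (f j)) →
      (∀ i j, i ≠ j → G.Adj (g i) (g j)) → ¬ ∀ i j, f i ≠ g j ∧ ¬ G.Adj (f i) (g j)) :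
    (∃ r, 1 ≤ r ∧ Nonempty (G ≃g clique r)) ∨
    (∃ s t, 3 ≤ s ∧ 1 ≤ t ∧ Nonempty (G ≃g cliqueUnionIsolated s t)) ∨
    (∃ m t, 2 ≤ m + t ∧ Nonempty (G ≃g edgesUnionIsolated m t)) := by
  classical
  by_cases htop : G = ⊤
  · subst htop
    exact .inl ⟨Nat.card V, Nat.card_pos, nonempty_iso_clique⟩
  refine .inr ?_
  have htrans : ∀ x y z, G.Adj x y → G.Adj y z → x ≠ z → G.Adj x z := fun x y z h1 h2 h3 => by
    by_contra h4
    exact hP (hasInducedP3_iff.2 ⟨x, y, z, h1.symm, h2, h3, h4⟩)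
  -- Without induced P₃, being equal or adjacent is transitive; the classes are the cliques.
  let S : Setoid V :=
    { r := fun u v => u = v ∨ G.Adj u v
      iseqv :=
        { refl := fun _ => .inl rfl
          symm := fun h => h.imp Eq.symm fun h => h.symm
          trans := by
            rintro x y z (rfl | h1) (rfl | h2)
            · exact .inl rfl
            · exact .inr h2
            · exact .inr h1
            · by_cases hxz : x = z
              · exact .inl hxz
              · exact .inr (htrans x y z h1 h2 hxz) } }
  let f : V → Quotient S := Quotient.mk S
  have hf : Function.Surjective f := Quotient.mk_surjective
  have hfe : ∀ u v, f u = f v ↔ u = v ∨ G.Adj u v := fun u v => Quotient.eq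
  have hG : ∀ u v, G.Adj u v ↔ u ≠ v ∧ f u = f v := fun u v => by
    rw [hfe]
    exact ⟨fun h => ⟨h.ne, .inr h⟩, fun h => h.2.resolve_left h.1⟩
  have : Nontrivial (Quotient S) := by
    obtain ⟨u, v, hne, h⟩ := SimpleGraph.ne_top_iff_exists_not_adj.1 htop
    exact ⟨f u, f v, fun e => h ((hG u v).2 ⟨hne, e⟩)⟩
  by_cases hbig : ∃ q, 3 ≤ Nat.card {v // f v = q}
  · obtain ⟨q₀, hq₀⟩ := hbig
    -- A second class with two vertices would give an induced K₃ ∪ K₂.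
    obtain ⟨t, ht, hiso⟩ := exists_iso_cliqueUnionIsolated hG hf q₀ fun q hq => by
      by_contra hne
      obtain ⟨v, hv⟩ := hf q
      have : Nonempty {v // f v = q} := ⟨⟨v, hv⟩⟩
      have hpos : 0 < Nat.card {v // f v = q} := Nat.card_pos
      have hsub (q : Quotient S) {k : ℕ} (hk : k ≤ Nat.card {v // f v = q}) :
          ∃ φ : Fin k → V, Function.Injective φ ∧ ∀ i, f (φ i) = q :=
        ⟨fun i => ((Finite.equivFin _).symm (Fin.castLE hk i)).1,
          Subtype.val_injective.comp ((Equiv.injective _).comp (Fin.castLE_injective hk)),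
          fun i => ((Finite.equivFin _).symm (Fin.castLE hk i)).2⟩
      obtain ⟨φ, hφ, hφq⟩ := hsub q₀ hq₀
      obtain ⟨ψ, hψ, hψq⟩ := hsub q (k := 2) (by omega)
      refine hK φ ψ (fun i j hij => (hG _ _).2 ⟨hφ.ne hij, by rw [hφq, hφq]⟩)
        (fun i j hij => (hG _ _).2 ⟨hψ.ne hij, by rw [hψq, hψq]⟩) fun i j => ⟨fun e => hq ?_,
          fun e => hq ?_⟩
      · rw [← hψq j, ← e, hφq]
      · rw [← hψq j, ← ((hG _ _).1 e).2, hφq]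
    exact .inl ⟨_, t, hq₀, ht, hiso⟩
  · push Not at hbig
    exact .inr (exists_iso_edgesUnionIsolated hG hf fun q => Nat.le_of_lt_succ (hbig q))

end cluster
end SimpleGraph

/-! ### Structure of the sides of a join in the class -/

namespace SimpleGraph

variable {V V₁ V₂ : Type*} [Fintype V] [DecidableEq V] [Nonempty V₁] [Nonempty V₂]
  {G : SimpleGraph V} {G₁ : SimpleGraph V₁} {G₂ : SimpleGraph V₂}

/-- In a join of the class, a side without induced `P₃` is complete, `K_s ∪ t K₁` or
`m K₂ ∪ t K₁`. -/
theorem InClassG.classification_left (hG : G.InClassG) (e : G ≃g G₁.join G₂)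
    (hP : ¬ G₁.HasInducedP3) :
    (∃ r, 1 ≤ r ∧ Nonempty (G₁ ≃g clique r)) ∨
    (∃ s t, 3 ≤ s ∧ 1 ≤ t ∧ Nonempty (G₁ ≃g cliqueUnionIsolated s t)) ∨
    (∃ m t, 2 ≤ m + t ∧ Nonempty (G₁ ≃g edgesUnionIsolated m t)) := by
  have : Finite V₁ := Finite.of_injective (fun v => e.symm (.inl v))
    (e.symm.injective.comp Sum.inl_injective)
  have hadj (a b : V₁) : G.Adj (e.symm (.inl a)) (e.symm (.inl b)) ↔ G₁.Adj a b := by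
    rw [e.symm.map_adj_iff, join_adj_inl_inl]
  refine classification_of_not_hasInducedP3 hP fun f g hf hg hfg => ?_
  refine hG.not_triangle_union_edge ((hasCommonNeighbors_join G₁ G₂).of_iso e)
    (f := fun i => e.symm (.inl (f i))) (g := fun i => e.symm (.inl (g i)))
    (fun i j h => (hadj _ _).2 (hf i j h)) (fun i j h => (hadj _ _).2 (hg i j h)) fun i j =>
      ⟨fun h => (hfg i j).1 (Sum.inl_injective (e.symm.injective h)),
        fun h => (hfg i j).2 ((hadj _ _).1 h)⟩

/-- In a join of the class, a side with an induced `P₃` is the join of a clique with a graph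
without induced `P₃`, and the other side is complete. -/
theorem InClassG.decomposition_of_left (hG : G.InClassG) (e : G ≃g G₁.join G₂)
    (hP : G₁.HasInducedP3) :
    ∃ (r p q : ℕ) (F₁ : SimpleGraph (Fin p)) (F₂ : SimpleGraph (Fin q)),
      1 ≤ r ∧ 1 ≤ p ∧ 1 ≤ q ∧ ¬ F₁.HasInducedP3 ∧ ¬ F₂.HasInducedP3 ∧
      Nonempty (G ≃g ((clique r).join F₁).join F₂) := by
  classical
  have : Finite V₁ := Finite.of_injective (fun v => e.symm (.inl v))
    (e.symm.injective.comp Sum.inl_injective)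
  have : Finite V₂ := Finite.of_injective (fun v => e.symm (.inr v))
    (e.symm.injective.comp Sum.inr_injective)
  have hC := (hasCommonNeighbors_join G₁ G₂).of_iso e
  have key {x z y u w : V₁ ⊕ V₂} (hxz : x ≠ z) (hyu : y ≠ u) (nxz : ¬ (G₁.join G₂).Adj x z)
      (nyu : ¬ (G₁.join G₂).Adj y u) (hyx : (G₁.join G₂).Adj y x) (hyz : (G₁.join G₂).Adj y z)
      (hwx : (G₁.join G₂).Adj w x) (hwz : (G₁.join G₂).Adj w z) (hwy : (G₁.join G₂).Adj w y)
      (hwu : (G₁.join G₂).Adj w u) : False := by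
    rw [← e.symm.map_adj_iff] at nxz nyu hyx hyz hwx hwz hwy hwu
    exact hG.not_two_nonadjacent_pairs hC (e.symm.injective.ne hxz) (e.symm.injective.ne hyu)
      nxz nyu hyx hyz hwx hwz hwy hwu
  let S : V₁ → Prop := fun a => ∀ b, b ≠ a → G₁.Adj a b
  -- A non-neighbour u of y would complete the forbidden configuration, with w any vertex of the
  -- other side.
  have hmid {x y z : V₁} (hyx : G₁.Adj y x) (hyz : G₁.Adj y z) (hne : x ≠ z)
      (nxz : ¬ G₁.Adj x z) : S y := by
    by_contra hy
    simp only [S, not_forall] at hy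
    obtain ⟨u, hu, nyu⟩ := hy
    exact key (x := .inl x) (z := .inl z) (y := .inl y) (u := .inl u)
      (w := .inr (Classical.arbitrary V₂)) (by simpa) (by simpa using Ne.symm hu) (by simpa)
      (by simpa) (by simpa) (by simpa) (by simp) (by simp) (by simp) (by simp)
  obtain ⟨x, y, z, hyx, hyz, hne, nxz⟩ := hasInducedP3_iff.1 hP
  have hS : S y := hmid hyx hyz hne nxz
  have hx : ¬ S x := fun h => nxz (h z hne.symm)
  -- Here a nonadjacent pair of `G₂` is the second pair, and y, which dominates `G₁`, is the common
  -- neighbour.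
  have htop : G₂ = ⊤ := by
    by_contra h
    obtain ⟨c, d, hcd, ncd⟩ := ne_top_iff_exists_not_adj.1 h
    exact key (x := .inl x) (z := .inl z) (y := .inr c) (u := .inr d) (w := .inl y)
      (by simpa) (by simpa) (by simpa) (by simpa) (by simp) (by simp) (by simpa) (by simpa)
      (by simp) (by simp)
  subst htop
  let F := G₁.comap (Subtype.val : {a // ¬ S a} → V₁)
  have hF : ¬ F.HasInducedP3 := by
    intro h
    obtain ⟨a, b, c, h1, h2, h3, h4⟩ := hasInducedP3_iff.1 h
    exact b.2 (hmid h1 h2 (Subtype.val_injective.ne h3) h4)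
  have : Nonempty {a // S a} := ⟨⟨y, hS⟩⟩
  have : Nonempty {a // ¬ S a} := ⟨⟨x, hx⟩⟩
  let eF : F ≃g F.map (Finite.equivFin {a // ¬ S a}).toEmbedding := Iso.map _ F
  -- `F₁` is the non-dominating part of `G₁`, and `F₂` is the complete graph `G₂`.
  refine ⟨Nat.card {a // S a}, Nat.card {a // ¬ S a}, Nat.card V₂, _, clique (Nat.card V₂),
    Nat.card_pos, Nat.card_pos, Nat.card_pos, fun h => hF (h.of_iso eF.symm), ?_, ?_⟩
  · intro h
    obtain ⟨a, b, c, -, -, h3, h4⟩ := hasInducedP3_iff.1 h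
    exact h4 h3
  · exact ⟨e.trans (Iso.join ((isoJoinOfDominating G₁ S fun a h => h).trans
      (Iso.join nonempty_iso_clique.some eF)) nonempty_iso_clique.some)⟩

end SimpleGraph


theorem theorem3p12 {V V₁ V₂ : Type*} [Fintype V] [DecidableEq V] [Nonempty V₁] [Nonempty V₂]
    (G : SimpleGraph V) (G₁ : SimpleGraph V₁) (G₂ : SimpleGraph V₂)
    (hjoin : Nonempty (G ≃g G₁.join G₂)) (hG : G.InClassG) :
    ((¬ G₁.HasInducedP3 ∧ ¬ G₂.HasInducedP3) →
      (∃ r s t : ℕ, 1 ≤ r ∧ 1 ≤ t ∧ 3 ≤ s ∧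
        Nonempty (G ≃g (SimpleGraph.clique r).join (SimpleGraph.cliqueUnionIsolated s t))) ∨
      (∃ r m t : ℕ, 1 ≤ r ∧ 2 ≤ m + t ∧
        Nonempty (G ≃g (SimpleGraph.clique r).join (SimpleGraph.edgesUnionIsolated m t))) ∨
      (∃ s₁ t₁ s₂ t₂ : ℕ, 3 ≤ s₁ ∧ 3 ≤ s₂ ∧ 1 ≤ t₁ ∧ 1 ≤ t₂ ∧
        Nonempty (G ≃g (SimpleGraph.cliqueUnionIsolated s₁ t₁).join
          (SimpleGraph.cliqueUnionIsolated s₂ t₂))) ∨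
      (∃ s t₁ m t₂ : ℕ, 3 ≤ s ∧ 1 ≤ t₁ ∧ 2 ≤ m + t₂ ∧
        Nonempty (G ≃g (SimpleGraph.cliqueUnionIsolated s t₁).join
          (SimpleGraph.edgesUnionIsolated m t₂))) ∨
      (∃ m₁ t₁ m₂ t₂ : ℕ, 2 ≤ m₁ + t₁ ∧ 2 ≤ m₂ + t₂ ∧
        Nonempty (G ≃g (SimpleGraph.edgesUnionIsolated m₁ t₁).join
          (SimpleGraph.edgesUnionIsolated m₂ t₂)))) ∧
    ((G₁.HasInducedP3 ∨ G₂.HasInducedP3) →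
      ∃ (r p q : ℕ) (F₁ : SimpleGraph (Fin p)) (F₂ : SimpleGraph (Fin q)),
        1 ≤ r ∧ 1 ≤ p ∧ 1 ≤ q ∧ ¬ F₁.HasInducedP3 ∧ ¬ F₂.HasInducedP3 ∧
        Nonempty (G ≃g ((SimpleGraph.clique r).join F₁).join F₂)) := by
  obtain ⟨e⟩ := hjoin
  have e' := e.trans (SimpleGraph.joinComm G₁ G₂)
  refine ⟨fun ⟨h₁, h₂⟩ => ?_, ?_⟩
  · rcases hG.classification_left e h₁ with
      ⟨r, hr, ⟨f⟩⟩ | ⟨s, t, hs, ht, ⟨f⟩⟩ | ⟨m, t, hm, ⟨f⟩⟩ <;>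
    rcases hG.classification_left e' h₂ with
      ⟨r', hr', ⟨f'⟩⟩ | ⟨s', t', hs', ht', ⟨f'⟩⟩ | ⟨m', t', hm', ⟨f'⟩⟩
    -- Two complete sides would make G complete.
    · refine absurd ?_ hG.2.1
      have g := e.trans (f.join f')
      ext u v
      rw [SimpleGraph.top_adj, ← SimpleGraph.Iso.map_adj_iff g, ← g.injective.ne_iff]
      rcases g u with a | a <;> rcases g v with b | b <;> simp
    · exact .inl ⟨r, s', t', hr, ht', hs', ⟨e.trans (f.join f')⟩⟩
    · exact .inr (.inl ⟨r, m', t', hr, hm', ⟨e.trans (f.join f')⟩⟩)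
    · exact .inl ⟨r', s, t, hr', ht, hs, ⟨e'.trans (f'.join f)⟩⟩
    · exact .inr (.inr (.inl ⟨s, t, s', t', hs, hs', ht, ht', ⟨e.trans (f.join f')⟩⟩))
    · exact .inr (.inr (.inr (.inl ⟨s, t, m', t', hs, ht, hm', ⟨e.trans (f.join f')⟩⟩)))
    · exact .inr (.inl ⟨r', m, t, hr', hm, ⟨e'.trans (f'.join f)⟩⟩)
    · exact .inr (.inr (.inr (.inl ⟨s', t', m, t, hs', ht', hm, ⟨e'.trans (f'.join f)⟩⟩)))
    · exact .inr (.inr (.inr (.inr ⟨m, t, m', t', hm, hm', ⟨e.trans (f.join f')⟩⟩)))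
  · rintro (h | h)
    · exact hG.decomposition_of_left e h
    · exact hG.decomposition_of_left e' h
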